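/- For integers $m_1,\dots,m_k\ge 2$ let $G=\gamma_1\times\cdots\times\gamma_k$ be the $k$-dimensional torus whose $i$-th factor (dimension) $\gamma_i$ is the undirected cycle on $m_i$ vertices; here the cycle on two vertices is a single edge. Two vertices of $G$ are adjacent if they differ in exactly one coordinate $i$ and are adjacent in $\gamma_i$ there; the edge is then said to lie in dimension $i$. A Hamiltonian cycle of $G$ is a cyclic enumeration of all the vertices, each exactly once, in which consecutive vertices are adjacent (on the graph with two vertices and one edge, going back and forth counts as one). The run length $\mathrm{rl}(H)$ of a Hamiltonian cycle $H$ is the maximum $r$ such that any $r$ (cyclically) consecutive edges of $H$ include at most one edge in any one dimension, and $\mathrm{mrl}(G)$ is the maximum of $\mathrm{rl}(H)$ over all Hamiltonian cycles $H$ of $G$. **Theorem.** Let $p$ be a prime and $k$ an integer, and let $G=\gamma_1\times\cdots\times\gamma_k$ be a $k$-dimensional torus, each $\gamma_i$ an undirected cycle on at least two vertices, whose number of vertices is $|G|=p^r$ for some positive integer $r$. Then $$\mathrm{mrl}(G)\;\ge\;\left\lfloor \frac{k}{3}\right\rfloor+1 .$$ -/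

import Mathlib

namespace RunLength

/-- The Cartesian product of a family of graphs, one factor for each dimension `i : ι`: two
vertices are adjacent when they are adjacent in exactly one coordinate and agree in all others. -/
def cartesianProduct {ι : Type*} {V : ι → Type*} (γ : ∀ i, SimpleGraph (V i)) :
    SimpleGraph (∀ i, V i) where
  Adj x y := ∃ i, (γ i).Adj (x i) (y i) ∧ ∀ j, j ≠ i → x j = y j
  symm := ⟨fun _ _ ⟨i, h, h'⟩ => ⟨i, h.symm, fun j hj => (h' j hj).symm⟩⟩
  loopless := ⟨fun _ ⟨_, h, _⟩ => h.ne rfl⟩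

/-- A Hamiltonian cycle of a finite graph, as a cyclic enumeration of the vertices: each vertex is
listed exactly once, and each one is adjacent to the next, the last one to the first.
With at least three vertices this is a Hamiltonian cycle in the usual sense (with a starting vertex
and an orientation); on the graph with two vertices and one edge, it is the cycle on
two vertices that goes back and forth, and a graph with one vertex or none has no such cycle. -/
structure HamiltonianCycle {V : Type*} [Finite V] (G : SimpleGraph V) where
  /-- The vertex at each (cyclic) time. -/
  vertex : ZMod (Nat.card V) ≃ V
  adj : ∀ t, G.Adj (vertex t) (vertex (t + 1))

section

variable {ι : Type*} [Finite ι] {V : ι → Type*} [∀ i, Finite (V i)] {γ : ∀ i, SimpleGraph (V i)}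

/-- The edge of `H` from its vertex at time `t` to the next one lies in dimension `i`. -/
def HamiltonianCycle.EdgeInDim (H : HamiltonianCycle (cartesianProduct γ))
    (t : ZMod (Nat.card (∀ i, V i))) (i : ι) : Prop :=
  H.vertex t i ≠ H.vertex (t + 1) i

/-- Any `r` consecutive edges of `H`, cyclically, contain at most one edge in any one dimension. -/
def HamiltonianCycle.HasRun (H : HamiltonianCycle (cartesianProduct γ)) (r : ℕ) : Prop :=
  ∀ (t : ZMod (Nat.card (∀ i, V i))) (i : ι) (a b : ℕ), a < r → b < r →
    H.EdgeInDim (t + a) i → H.EdgeInDim (t + b) i → a = b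

/-- The run length of `H`: the maximum `r` such that any `r` consecutive edges of `H` contain at
most one edge in any one dimension. -/
noncomputable def HamiltonianCycle.runLength (H : HamiltonianCycle (cartesianProduct γ)) : ℕ :=
  sSup {r : ℕ | H.HasRun r}

/-- The maximum run length over all Hamiltonian cycles of the product of the `γ i`. -/
noncomputable def maxRunLength (γ : ∀ i, SimpleGraph (V i)) : ℕ :=
  sSup (Set.range fun H : HamiltonianCycle (cartesianProduct γ) => H.runLength)

/-- Every edge lies in some dimension, so `r` cannot exceed the number of dimensions. -/
theorem HamiltonianCycle.HasRun.le_card {H : HamiltonianCycle (cartesianProduct γ)} {r : ℕ}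
    (h : H.HasRun r) : r ≤ Nat.card ι := by
  have hd : ∀ t, ∃ i, H.EdgeInDim t i := fun t =>
    let ⟨i, hi, _⟩ := H.adj t
    ⟨i, hi.ne⟩
  choose d hd using hd
  have hinj : Function.Injective fun a : Fin r => d (0 + (a : ℕ)) := fun a b hab =>
    Fin.ext (h 0 _ a b a.2 b.2 (hd _) (by
      have := hd (0 + ((b : ℕ) : ZMod (Nat.card (∀ i, V i))))
      rwa [← show d (0 + (a : ℕ)) = d (0 + (b : ℕ)) from hab] at this))
  simpa using Nat.card_le_card_of_injective _ hinj

/-- The maximum in the definition of the run length is attained. -/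
theorem HamiltonianCycle.isGreatest_runLength (H : HamiltonianCycle (cartesianProduct γ)) :
    IsGreatest {r : ℕ | H.HasRun r} H.runLength := by
  have hb : BddAbove {r : ℕ | H.HasRun r} := ⟨_, fun _ h => h.le_card⟩
  exact ⟨Nat.sSup_mem ⟨0, fun _ _ _ _ h => absurd h (Nat.not_lt_zero _)⟩ hb,
    fun _ h => le_csSup hb h⟩

/-- If there is a Hamiltonian cycle, the maximum run length is attained. -/
theorem isGreatest_maxRunLength (γ : ∀ i, SimpleGraph (V i))
    (H₀ : HamiltonianCycle (cartesianProduct γ)) :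
    IsGreatest (Set.range fun H : HamiltonianCycle (cartesianProduct γ) => H.runLength)
      (maxRunLength γ) := by
  have hb : BddAbove
      (Set.range fun H : HamiltonianCycle (cartesianProduct γ) => H.runLength) :=
    ⟨Nat.card ι, by rintro _ ⟨H, rfl⟩; exact H.isGreatest_runLength.1.le_card⟩
  exact ⟨Nat.sSup_mem ⟨_, H₀, rfl⟩ hb, fun _ h => le_csSup hb h⟩

end

end RunLength

namespace RunLength

/-! Run lengths combine under products. Let `X` and `Y` be enumerated with run lengths `r₁` and
`r₂`, where `|Y|` divides `|X|`, and interleave the two enumerations along a balanced word in which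
steps in `X` have density `c / |Y|`. If `c` is prime to `|X|`, every pair is reached; the run length
is at least `L` once `L` consecutive steps contain at most `r₁` steps in `X` and `r₂` in `Y`
(`HasCycle.prod`). For powers of `p` the divisibility is automatic, and a suitable `c` exists if `r₁
+ r₂ = L + 1` and the smaller factor has at least `2 * L` elements (`exists_coprime_balanced`).
Splitting off about half of the dimensions, a multiple of three, fits the formula `⌊k/3⌋ + 1`
exactly, so induction leaves only three-dimensional tori with run length 2 (`hasCycle_of_three`).

Let their sides be `A`, `B`, `C`, powers of `p` with `C ∣ B ∣ A`. A word of length `B * C` is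
repeated `A` times. If `C ≠ 3`, it consists of `B` rows of `C` positive letters: the place in the
row fixes the coordinate sum mod `C`, the row fixes coordinate 1, the repetition fixes coordinate 0
(`hasCycle_of_two_words`). If `C = 3`, such rows do not exist; a signed word with displacement `(1,
-1, -1)` is used, which only has to cover the quotient by that vector (`hasCycle_of_word_three`). -/

/-- A cyclic enumeration of a finite type `X`, the step at time `t` being one of kind `d t`, in
which any `r` consecutive steps are of different kinds. -/
def HasCycle {ι X : Type*} (S : ι → X → X → Prop) (r : ℕ) : Prop :=
  ∃ (P : ℕ → X) (d : ℕ → ι), Function.Surjective P ∧ Function.Periodic P (Nat.card X) ∧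
    (∀ t, S (d t) (P t) (P (t + 1))) ∧ ∀ s t, s < t → t < s + r → d s ≠ d t

/-- Adjacency in the product of cycles, along dimension `i`. -/
def CycleStep {ι : Type*} (m : ι → ℕ) (i : ι) (x y : ∀ i, ZMod (m i)) : Prop :=
  (y i = x i + 1 ∨ y i = x i - 1) ∧ ∀ j, j ≠ i → y j = x j

/-! ### From enumerations to the run length of a torus -/

theorem HasCycle.map {ι κ X Y : Type*} {S : ι → X → X → Prop} {T : κ → Y → Y → Prop} {r : ℕ}
    (h : HasCycle S r) (e : ι ↪ κ) (φ : X ≃ Y) (hST : ∀ i x y, S i x y → T (e i) (φ x) (φ y)) :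
    HasCycle T r := by
  obtain ⟨P, d, hP, hper, hS, hd⟩ := h
  refine ⟨φ ∘ P, e ∘ d, φ.surjective.comp hP, fun t => ?_, fun t => hST _ _ _ (hS t),
    fun s t hst htr he => hd s t hst htr (e.injective he)⟩
  rw [← Nat.card_congr φ]
  exact congrArg φ (hper t)

/-- A periodic surjection whose period is the number of vertices is a bijection on cyclic times.
Windows that cross time 0 need no separate care, because `d` is constrained at all natural times. -/
theorem HasCycle.le_maxRunLength {ι : Type*} [Finite ι] {V : ι → Type*} [∀ i, Finite (V i)]
    {γ : ∀ i, SimpleGraph (V i)} {r : ℕ}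
    (h : HasCycle (fun i (x y : ∀ i, V i) => (γ i).Adj (x i) (y i) ∧ ∀ j, j ≠ i → x j = y j) r) :
    r ≤ maxRunLength γ := by
  obtain ⟨P, d, hP, hper, hS, hd⟩ := h
  have : Nonempty (∀ i, V i) := ⟨P 0⟩
  have : NeZero (Nat.card (∀ i, V i)) := ⟨Nat.card_pos.ne'⟩
  have hcast : ∀ k : ℕ, P ((k : ZMod (Nat.card (∀ i, V i))).val) = P k := fun k => by
    rw [ZMod.val_natCast, hper.map_mod_nat]
  have hsurj : Function.Surjective fun t : ZMod (Nat.card (∀ i, V i)) => P t.val := fun x => by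
    obtain ⟨k, rfl⟩ := hP x
    exact ⟨k, hcast k⟩
  have hbij := hsurj.bijective_of_nat_card_le (by simp)
  have hsucc : ∀ t : ZMod (Nat.card (∀ i, V i)), P (t + 1).val = P (t.val + 1) := fun t => by
    rw [← hcast (t.val + 1)]
    simp
  let H : HamiltonianCycle (cartesianProduct γ) :=
    { vertex := Equiv.ofBijective _ hbij
      adj := fun t => ⟨d t.val, by
        simp only [Equiv.ofBijective_apply, hsucc]
        exact hS t.val⟩ }
  have hedge : ∀ (t : ZMod (Nat.card (∀ i, V i))) (a : ℕ) (i : ι), H.EdgeInDim (t + a) i →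
      i = d (t.val + a) := by
    intro t a i hi
    by_contra hne
    apply hi
    have h1 : t + (a : ZMod (Nat.card (∀ i, V i))) = ((t.val + a : ℕ) : ZMod _) := by simp
    have h2 : H.vertex (t + a) = P (t.val + a) := by
      rw [h1]; exact hcast _
    have h3 : H.vertex (t + a + 1) = P (t.val + a + 1) := by
      rw [h1, ← Nat.cast_add_one]; exact hcast _
    rw [h2, h3]
    exact (hS (t.val + a)).2 i hne
  have hrun : H.HasRun r := by
    intro t i a b ha hb hia hib
    have hab := (hedge t a i hia).symm.trans (hedge t b i hib)
    by_contra hne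
    rcases Nat.lt_or_gt_of_ne hne with h | h
    · exact hd _ _ (by omega) (by omega) hab
    · exact hd _ _ (by omega) (by omega) hab.symm
  exact (H.isGreatest_runLength.2 hrun).trans ((isGreatest_maxRunLength γ H).2 ⟨H, rfl⟩)

theorem exists_zmod_equiv_fin_adj {m : ℕ} (hm : 2 ≤ m) :
    ∃ φ : ZMod m ≃ Fin m, ∀ x y, (y = x + 1 ∨ y = x - 1) →
      (SimpleGraph.cycleGraph m).Adj (φ x) (φ y) := by
  obtain ⟨n, rfl⟩ := Nat.exists_eq_add_of_le' hm
  have h : ∀ x y : Fin (n + 2), (y = x + 1 ∨ y = x - 1) →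
      (SimpleGraph.cycleGraph (n + 2)).Adj x y := by
    intro x y h
    rw [SimpleGraph.cycleGraph_adj]
    rcases h with rfl | rfl
    · exact Or.inr (by simp)
    · exact Or.inl (by simp)
  exact ⟨Equiv.refl (Fin (n + 2)), h⟩

theorem exists_dvd_add_mul_sub {M : ℕ} (hM : 0 < M) {c : ℤ} (hc : IsCoprime c M) (x y : ℤ) :
    ∃ n : ℕ, (M : ℤ) ∣ x + n * c - y := by
  obtain ⟨a, b, hab⟩ := hc
  refine ⟨((y - x) * a % M).toNat, ?_⟩
  rw [Int.toNat_of_nonneg (Int.emod_nonneg _ (by omega)), Int.emod_def]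
  exact ⟨-((y - x) * b) - c * ((y - x) * a / M), by linear_combination (y - x) * hab⟩

theorem HasCycle.le_maxRunLength_cycleGraph {ι : Type*} [Finite ι] {m : ι → ℕ}
    (hm : ∀ i, 2 ≤ m i) {r : ℕ} (h : HasCycle (CycleStep m) r) :
    r ≤ maxRunLength fun i => SimpleGraph.cycleGraph (m i) := by
  choose φ hφ using fun i => exists_zmod_equiv_fin_adj (hm i)
  refine HasCycle.le_maxRunLength (h.map (Function.Embedding.refl ι) (Equiv.piCongrRight φ) ?_)
  rintro i x y ⟨h1, h2⟩
  exact ⟨hφ i _ _ h1, fun j hj => congrArg (φ j) (h2 j hj).symm⟩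

theorem HasCycle.reindex {ι κ : Type*} {m : κ → ℕ} (e : ι ≃ κ) {r : ℕ}
    (h : HasCycle (CycleStep fun i => m (e i)) r) : HasCycle (CycleStep m) r := by
  refine h.map e.toEmbedding (Equiv.piCongrLeft (fun j => ZMod (m j)) e) ?_
  rintro i x y ⟨h1, h2⟩
  refine ⟨?_, fun j => ?_⟩
  · simpa using h1
  · obtain ⟨j, rfl⟩ := e.surjective j
    intro hj
    simpa using h2 j fun h => hj (by simp [h])

/-! ### Balanced interleaving of two enumerations -/

/-- A product of two enumerations, interleaved along a balanced periodic word: in any `N`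
consecutive steps, `c` are steps of the first one. -/
theorem HasCycle.prod {ι κ X Y : Type*} [Finite X] [Finite Y] {S : ι → X → X → Prop}
    {T : κ → Y → Y → Prop} {r₁ r₂ L c : ℕ} (hS : HasCycle S r₁) (hT : HasCycle T r₂)
    (hdvd : Nat.card Y ∣ Nat.card X) (hc : c.Coprime (Nat.card X)) (hcN : c ≤ Nat.card Y)
    (h₁ : L * c ≤ r₁ * Nat.card Y) (h₂ : L * (Nat.card Y - c) ≤ r₂ * Nat.card Y) :
    HasCycle (fun (i : ι ⊕ κ) (x y : X × Y) =>
      Sum.elim (fun i => S i x.1 y.1 ∧ x.2 = y.2) (fun i => T i x.2 y.2 ∧ x.1 = y.1) i) L := by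
  obtain ⟨P, d, hP, hPper, hPS, hd⟩ := hS
  obtain ⟨Q, f, hQ, hQper, hQT, hf⟩ := hT
  have : Nonempty X := ⟨P 0⟩
  have : Nonempty Y := ⟨Q 0⟩
  have hXY : Nat.card (X × Y) = Nat.card X * Nat.card Y := Nat.card_prod X Y
  have hM : 0 < Nat.card X := Nat.card_pos
  have hN : 0 < Nat.card Y := Nat.card_pos
  rw [HasCycle, hXY]
  generalize Nat.card X = M at *
  generalize Nat.card Y = N at *
  obtain ⟨q, rfl⟩ := hdvd
  -- `a t` counts the steps of the first enumeration before time `t`, and `t - a t` those of the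
  -- second. The floor spreads the former evenly.
  set a : ℕ → ℕ := fun t => t * c / N with ha
  have ha_le : ∀ t, a t ≤ t := fun t => Nat.div_le_of_le_mul (by
    rw [mul_comm N]; exact Nat.mul_le_mul_left t hcN)
  have ha_add : ∀ t n, a (t + n * N) = a t + n * c := fun t n => by
    simp only [ha]
    rw [show (t + n * N) * c = t * c + n * c * N by ring, Nat.add_mul_div_right _ _ hN]
  have ha_mono : Monotone a := fun s t h => Nat.div_le_div_right (Nat.mul_le_mul_right c h)
  have ha_lt : ∀ t k r, k * c ≤ r * N → a (t + k) ≤ a t + r := fun t k r h => by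
    simp only [ha]
    rw [← Nat.add_mul_div_right _ _ hN]
    exact Nat.div_le_div_right (by rw [add_mul]; omega)
  have ha_succ : ∀ t, a (t + 1) ≤ a t + 1 := fun t => ha_lt t 1 1 (by omega)
  -- `t - a t` is the ceiling of `t * (N - c) / N`, so `h₂` bounds its growth over a window of
  -- length `L`.
  have hb_lt : ∀ t, t + L - a (t + L) ≤ t - a t + r₂ := fun t => by
    have h1 : t * c < (a t + 1) * N := by
      have := Nat.lt_div_mul_add hN (a := t * c)
      simp only [ha]; rw [add_mul, one_mul]; exact this
    have h2 : t + L ≤ a (t + L) + (t - a t + r₂) := by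
      by_contra hcon
      have h3 : a (t + L) + (t - a t) + r₂ + 1 ≤ t + L := by omega
      have h4 : (t + L) * c < (a (t + L) + 1) * N := by
        have := Nat.lt_div_mul_add hN (a := (t + L) * c)
        simp only [ha]; rw [add_mul _ 1, one_mul]; exact this
      have h5 : a t * N ≤ t * c := Nat.div_mul_le_self _ _
      have h6 := ha_le t
      zify [hcN, h6] at *
      nlinarith
    omega
  have hstep : ∀ t, a (t + 1) = a t ∨ a (t + 1) = a t + 1 := fun t => by
    have := ha_mono (Nat.le_succ t)
    have := ha_succ t
    simp only [Nat.succ_eq_add_one] at *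
    omega
  refine ⟨fun t => (P (a t), Q (t - a t)),
    fun t => if a (t + 1) = a t then Sum.inr (f (t - a t)) else Sum.inl (d (a t)), ?_, ?_, ?_, ?_⟩
  · rintro ⟨x, y⟩
    obtain ⟨u, rfl⟩ := hP x
    obtain ⟨v, rfl⟩ := hQ y
    -- The two indices sum to the time, so the time must be `u + v` mod `N`. Adding `n * N` to it
    -- moves the first index by `n * c`, which reaches `u` mod `|X|` for some `n`; the second is
    -- then right mod `N`, as `N` divides `|X|`.
    obtain ⟨n, hn⟩ := exists_dvd_add_mul_sub hM (Nat.isCoprime_iff_coprime.2 hc)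
      (a ((u + v) % N)) u
    have hu : a ((u + v) % N + n * N) ≡ u [MOD N * q] := by
      rw [ha_add, Nat.modEq_iff_dvd, ← dvd_neg]
      push_cast at hn ⊢
      simpa [add_sub_assoc] using hn
    have hv : (u + v) % N + n * N - a ((u + v) % N + n * N) ≡ v [MOD N] := by
      refine Nat.ModEq.add_right_cancel (hu.of_mul_right q) ?_
      rw [Nat.sub_add_cancel (ha_le _), add_comm v u]
      simp [Nat.ModEq]
    refine ⟨(u + v) % N + n * N, ?_⟩
    dsimp only
    rw [← hPper.map_mod_nat, hu, hPper.map_mod_nat, ← hQper.map_mod_nat, hv, hQper.map_mod_nat]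
  · intro t
    have h1 : a (t + N * q * N) = a t + c * (N * q) := by rw [ha_add, mul_comm c]
    have h2 : t + N * q * N - a (t + N * q * N) = t - a t + q * (N - c) * N := by
      have := ha_le t
      rw [h1]
      zify [hcN, ha_le t, show a t + c * (N * q) ≤ t + N * q * N by
        have := Nat.mul_le_mul_right (N * q) hcN; rw [mul_comm N (N * q)] at this; omega]
      ring
    dsimp only
    rw [h2, h1, ← hPper.map_mod_nat, Nat.add_mul_mod_self_right, hPper.map_mod_nat,
      ← hQper.map_mod_nat, Nat.add_mul_mod_self_right, hQper.map_mod_nat]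
  · intro t
    have := ha_le t
    rcases hstep t with h | h
    · have h2 : t + 1 - a t = t - a t + 1 := by omega
      simp [h, h2, hQT]
    · have h2 : t + 1 - (a t + 1) = t - a t := by omega
      simp [h, h2, hPS]
  · intro s t hst htL
    have hmono := ha_mono (show s + 1 ≤ t by omega)
    have hmono' := ha_mono (show t + 1 ≤ s + L by omega)
    have hls := ha_le s
    have hlt := ha_le t
    have h1 := ha_lt s L r₁ h₁
    have h2 := hb_lt s
    have hsub : Monotone fun u => u - a u := monotone_nat_of_le_succ fun u => by
      have := ha_succ u
      omega
    have h3 : s + 1 - a (s + 1) ≤ t - a t := hsub (by omega)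
    have h4 : t + 1 - a (t + 1) ≤ s + L - a (s + L) := hsub (by omega)
    rcases hstep s with h | h <;> rcases hstep t with h' | h' <;> simp only [h, h'] <;> simp
    · exact hf _ _ (by omega) (by omega)
    · exact hd _ _ (by omega) (by omega)

/-! ### Lattice walks -/

/-- A walk in the integer lattice that covers all residues is an enumeration of the torus. -/
theorem hasCycle_of_walk {ι : Type*} [Fintype ι] {m : ι → ℕ} {r : ℕ} (N : ℕ → ι → ℤ) (d : ℕ → ι)
    (hstep : ∀ t, (N (t + 1) (d t) = N t (d t) + 1 ∨ N (t + 1) (d t) = N t (d t) - 1) ∧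
      ∀ j, j ≠ d t → N (t + 1) j = N t j)
    (hper : ∀ t i, (m i : ℤ) ∣ N (t + ∏ i, m i) i - N t i)
    (hsurj : ∀ g : ι → ℤ, ∃ t, ∀ i, (m i : ℤ) ∣ N t i - g i)
    (hd : ∀ s t, s < t → t < s + r → d s ≠ d t) : HasCycle (CycleStep m) r := by
  refine ⟨fun t i => (N t i : ZMod (m i)), d, fun x => ?_, fun t => ?_, fun t => ⟨?_, ?_⟩, hd⟩
  · choose g hg using fun i => ZMod.intCast_surjective (x i)
    obtain ⟨t, ht⟩ := hsurj g
    refine ⟨t, funext fun i => ?_⟩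
    rw [← hg, eq_comm, ZMod.intCast_eq_intCast_iff_dvd_sub]
    exact ht i
  · have hcard : Nat.card (∀ i, ZMod (m i)) = ∏ i, m i := by simp [Nat.card_pi]
    refine funext fun i => ?_
    rw [hcard, eq_comm, ZMod.intCast_eq_intCast_iff_dvd_sub]
    exact hper t i
  · rcases (hstep t).1 with h | h <;> simp [h]
  · intro j hj
    simp [(hstep t).2 j hj]

theorem hasCycle_of_unique {ι : Type*} [Fintype ι] [Unique ι] {m : ι → ℕ}
    (hm : ∀ i, 0 < m i) : HasCycle (CycleStep m) 1 := by
  refine hasCycle_of_walk (fun t _ => t) (fun _ => default) (fun t => ⟨by simp, fun j hj => ?_⟩)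
    (fun t i => ?_) (fun g => ?_) fun s t _ _ => by omega
  · exact absurd (Subsingleton.elim j default) hj
  · rw [Subsingleton.elim i default]
    simp
  · obtain ⟨n, hn⟩ := exists_dvd_add_mul_sub (hm default) isCoprime_one_left 0 (g default)
    refine ⟨n, fun i => ?_⟩
    rw [Subsingleton.elim i default]
    simpa using hn

/-! ### Splitting the set of dimensions, and induction on its size -/

theorem HasCycle.of_subtypes {ι : Type*} [Finite ι] {m : ι → ℕ} [∀ i, NeZero (m i)]
    (q : ι → Prop) [DecidablePred q] {r₁ r₂ L c : ℕ}
    (hS : HasCycle (CycleStep fun i : {i // q i} => m i) r₁)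
    (hT : HasCycle (CycleStep fun i : {i // ¬q i} => m i) r₂)
    (hdvd : Nat.card (∀ i : {i // ¬q i}, ZMod (m i)) ∣ Nat.card (∀ i : {i // q i}, ZMod (m i)))
    (hc : c.Coprime (Nat.card (∀ i : {i // q i}, ZMod (m i))))
    (hcN : c ≤ Nat.card (∀ i : {i // ¬q i}, ZMod (m i)))
    (h₁ : L * c ≤ r₁ * Nat.card (∀ i : {i // ¬q i}, ZMod (m i)))
    (h₂ : L * (Nat.card (∀ i : {i // ¬q i}, ZMod (m i)) - c) ≤
      r₂ * Nat.card (∀ i : {i // ¬q i}, ZMod (m i))) : HasCycle (CycleStep m) L := by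
  refine (hS.prod hT hdvd hc hcN h₁ h₂).map (Equiv.sumCompl q).toEmbedding
    (Equiv.piEquivPiSubtypeProd q fun i => ZMod (m i)).symm ?_
  rintro (⟨i, hi⟩ | ⟨i, hi⟩) ⟨x, x'⟩ ⟨y, y'⟩ ⟨⟨h1, h2⟩, h3⟩
  · refine ⟨?_, fun j hj => ?_⟩
    · simp only [Equiv.piEquivPiSubtypeProd_symm_apply, Equiv.sumCompl_apply_inl,
        Equiv.coe_toEmbedding, hi, dite_true]
      exact h1
    by_cases hq : q j
    · simpa [hq] using h2 ⟨j, hq⟩ fun h => hj (by simp [← h])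
    · simpa [hq] using (congrFun h3 ⟨j, hq⟩).symm
  · refine ⟨?_, fun j hj => ?_⟩
    · simp only [Equiv.piEquivPiSubtypeProd_symm_apply, Equiv.sumCompl_apply_inr,
        Equiv.coe_toEmbedding, hi, dite_false]
      exact h1
    by_cases hq : q j
    · simpa [hq] using (congrFun h3 ⟨j, hq⟩).symm
    · simpa [hq] using h2 ⟨j, hq⟩ fun h => hj (by simp [← h])

/-- Of two powers of `p` one divides the other, so the smaller factor can serve as the second one.
In both cases `p ^ e` is its size and `c / p ^ e` is the density of the steps in `s`. -/
theorem HasCycle.of_finset {ι : Type*} [Fintype ι] [DecidableEq ι] {p : ℕ} (hp : p.Prime)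
    {a : ι → ℕ} (ha : ∀ i, 0 < a i) (s : Finset ι) (hs : 0 < s.card) (hs' : 0 < sᶜ.card)
    {r₁ r₂ L : ℕ} (hS : HasCycle (CycleStep fun i : {i // i ∈ s} => p ^ a i) r₁)
    (hT : HasCycle (CycleStep fun i : {i // i ∉ s} => p ^ a i) r₂)
    (hc : ∀ e, 0 < e → min s.card sᶜ.card ≤ e → ∃ c, c.Coprime p ∧ c ≤ p ^ e ∧
      L * c ≤ r₁ * p ^ e ∧ L * (p ^ e - c) ≤ r₂ * p ^ e) :
    HasCycle (CycleStep fun i => p ^ a i) L := by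
  have : ∀ i, NeZero (p ^ a i) := fun i => ⟨(pow_pos hp.pos _).ne'⟩
  have hM : Nat.card (∀ i : {i // i ∈ s}, ZMod (p ^ a i)) = p ^ ∑ i ∈ s, a i := by
    rw [Nat.card_pi, ← Finset.prod_pow_eq_pow_sum, ← Finset.prod_coe_sort s]
    simp
  have hN : Nat.card (∀ i : {i // i ∉ s}, ZMod (p ^ a i)) = p ^ ∑ i ∈ sᶜ, a i := by
    rw [Nat.card_pi, ← Finset.prod_pow_eq_pow_sum,
      ← Finset.prod_subtype (p := fun i => i ∉ s) sᶜ (by simp) fun i => Nat.card (ZMod (p ^ a i))]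
    simp
  have hle : ∀ u : Finset ι, u.card ≤ ∑ i ∈ u, a i := fun u => by
    simpa using Finset.card_nsmul_le_sum u a 1 fun i _ => ha i
  rcases le_total (∑ i ∈ sᶜ, a i) (∑ i ∈ s, a i) with h | h
  · obtain ⟨c, h1, h2, h3, h4⟩ := hc _ (hs'.trans_le (hle _)) ((min_le_right _ _).trans (hle _))
    refine HasCycle.of_subtypes (c := c) (fun i => i ∈ s) hS hT ?_ ?_ ?_ ?_ ?_
    · rw [hM, hN]; exact pow_dvd_pow p h
    · rw [hM]; exact h1.pow_right _
    all_goals rwa [hN]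
  · obtain ⟨c, h1, h2, h3, h4⟩ := hc _ (hs.trans_le (hle _)) ((min_le_left _ _).trans (hle _))
    have hM' : Nat.card (∀ i : {i // ¬i ∉ s}, ZMod (p ^ a i)) = p ^ ∑ i ∈ s, a i := by
      rw [← hM]
      exact Nat.card_congr (Equiv.piCongrLeft (fun i : {i // ¬i ∉ s} => ZMod (p ^ a i))
        (Equiv.subtypeEquivRight fun i => (not_not (a := i ∈ s)).symm)).symm
    -- The roles are exchanged, so the density is complemented; `N - c` stays prime to `p` because
    -- `p` divides `N`.
    refine HasCycle.of_subtypes (c := p ^ (∑ i ∈ s, a i) - c) (fun i => i ∉ s) hT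
      (HasCycle.reindex (Equiv.subtypeEquivRight fun i => (not_not (a := i ∈ s)).symm) hS)
      ?_ ?_ ?_ ?_ ?_
    · rw [hM', hN]; exact pow_dvd_pow p h
    · rw [hN]
      refine Nat.Coprime.pow_right _ ?_
      have hpd : p ∣ p ^ (∑ i ∈ s, a i) := dvd_pow_self p (hs.trans_le (hle _)).ne'
      rw [Nat.coprime_comm, hp.coprime_iff_not_dvd] at h1 ⊢
      intro h6
      exact h1 ((Nat.dvd_sub_iff_right h2 hpd).1 h6)
    · rw [hM']; exact Nat.sub_le _ _
    · rwa [hM']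
    · rwa [hM', Nat.sub_sub_self h2]

/-- The inequalities confine `c` to the interval from `N * (L - r₂) / L` to `N * r₁ / L`. Its length
`N / L` is at least 2, so it contains two consecutive integers, and `p` cannot divide both. -/
theorem exists_coprime_balanced {p N r₁ r₂ L : ℕ} (hp : p.Prime) (hL : 0 < L)
    (hr : r₁ + r₂ = L + 1) (hr₁ : r₁ ≤ L) (hr₂ : r₂ ≤ L) (hN : 2 * L ≤ N) :
    ∃ c, c.Coprime p ∧ c ≤ N ∧ L * c ≤ r₁ * N ∧ L * (N - c) ≤ r₂ * N := by
  obtain ⟨u, rfl⟩ : ∃ u, L = r₂ + u := Nat.exists_eq_add_of_le hr₂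
  have hu : r₁ = u + 1 := by omega
  subst hu
  -- The ceiling of `N * u / L`, the least integer in the interval.
  set c := (N * u + (r₂ + u - 1)) / (r₂ + u) with hc
  have h1 : N * u ≤ (r₂ + u) * c := by
    have h := Nat.lt_div_mul_add hL (a := N * u + (r₂ + u - 1))
    rw [← hc, mul_comm c] at h
    omega
  have h2 : (r₂ + u) * c ≤ N * u + (r₂ + u - 1) := by
    have h := Nat.div_mul_le_self (N * u + (r₂ + u - 1)) (r₂ + u)
    rwa [← hc, mul_comm c] at h
  have key : ∀ e, c ≤ e → e ≤ c + 1 →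
      e ≤ N ∧ (r₂ + u) * e ≤ (u + 1) * N ∧ (r₂ + u) * (N - e) ≤ r₂ * N := by
    intro e he he'
    have h3 : (r₂ + u) * e ≤ (u + 1) * N := by
      calc (r₂ + u) * e ≤ (r₂ + u) * (c + 1) := Nat.mul_le_mul_left _ he'
        _ = (r₂ + u) * c + (r₂ + u) := by ring
        _ ≤ N * u + N := by omega
        _ = (u + 1) * N := by ring
    have h4 : e ≤ N := Nat.le_of_mul_le_mul_left (h3.trans (Nat.mul_le_mul_right N hr₁)) hL
    refine ⟨h4, h3, ?_⟩
    have h5 := Nat.mul_le_mul_left (r₂ + u) he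
    zify [h4] at *
    linarith
  by_cases hpc : p ∣ c
  · refine ⟨c + 1, ?_, key _ (by omega) le_rfl⟩
    rw [Nat.coprime_comm, hp.coprime_iff_not_dvd]
    intro h
    exact hp.one_lt.ne' (Nat.dvd_one.1 ((Nat.dvd_add_right hpc).1 h))
  · exact ⟨c, (hp.coprime_iff_not_dvd.2 hpc).symm, key _ le_rfl (by omega)⟩

theorem four_mul_add_four_le_eight_pow {q : ℕ} (hq : 1 ≤ q) : 4 * q + 4 ≤ 2 ^ (3 * q) := by
  induction q, hq using Nat.le_induction with
  | base => norm_num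
  | succ q hq ih =>
    rw [show 3 * (q + 1) = 3 * q + 3 by ring, pow_add]
    omega

/-- From the three-dimensional tori to all the others. -/
theorem hasCycle_of_three {p : ℕ} (hp : p.Prime)
    (h3 : ∀ a : Fin 3 → ℕ, (∀ i, 0 < a i) → HasCycle (CycleStep fun i => p ^ a i) 2) (k : ℕ) :
    ∀ (ι : Type) [Fintype ι], Fintype.card ι = k → 0 < k → ∀ a : ι → ℕ, (∀ i, 0 < a i) →
      HasCycle (CycleStep fun i => p ^ a i) (k / 3 + 1) := by
  induction k using Nat.strong_induction_on with
  | _ k ih =>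
  intro ι _ hι hk a ha
  classical
  have split : ∀ n, 0 < n → n < k → (∀ e, 0 < e → min n (k - n) ≤ e → ∃ c, c.Coprime p ∧
      c ≤ p ^ e ∧ (k / 3 + 1) * c ≤ (n / 3 + 1) * p ^ e ∧
      (k / 3 + 1) * (p ^ e - c) ≤ ((k - n) / 3 + 1) * p ^ e) →
      HasCycle (CycleStep fun i => p ^ a i) (k / 3 + 1) := by
    intro n hn hnk hc
    obtain ⟨s, -, hs⟩ := Finset.exists_subset_card_eq (s := (Finset.univ : Finset ι)) (n := n)
      (by rw [Finset.card_univ]; omega)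
    have hs' : sᶜ.card = k - n := by rw [Finset.card_compl, hι, hs]
    refine HasCycle.of_finset hp ha s (by omega) (by omega)
      (ih n hnk _ (by simp [hs]) hn _ fun i => ha i)
      (ih (k - n) (by omega) _ (by rw [Fintype.card_subtype_compl]; simp [hs, hι]) (by omega) _
        fun i => ha i) ?_
    rwa [hs, hs']
  have hpow : ∀ e, 0 < e → 2 ≤ p ^ e := fun e he =>
    hp.two_le.trans (Nat.le_self_pow he.ne' p)
  rcases lt_or_ge k 6 with hk6 | hk6
  · interval_cases k
    · have : Unique ι := (Fintype.card_eq_one_iff_nonempty_unique.1 hι).some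
      exact hasCycle_of_unique fun i => pow_pos hp.pos _
    · exact split 1 one_pos one_lt_two fun e he _ =>
        ⟨1, Nat.coprime_one_left p, by have := hpow e he; omega, by have := hpow e he; omega,
          by omega⟩
    · exact (h3 (fun i => a ((Fintype.equivFinOfCardEq hι).symm i)) fun i => ha _).reindex
        (m := fun i => p ^ a i) (Fintype.equivFinOfCardEq hι).symm
    -- With `c = 1` the lone dimension is used once in `p ^ e ≥ 2` steps, never twice in a row.
    · exact split 1 one_pos (by omega) fun e he _ =>
        ⟨1, Nat.coprime_one_left p, by have := hpow e he; omega, by have := hpow e he; omega,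
          by omega⟩
    · exact split 1 one_pos (by omega) fun e he _ =>
        ⟨1, Nat.coprime_one_left p, by have := hpow e he; omega, by have := hpow e he; omega,
          by omega⟩
  -- As `n = 3 * (k / 6)` is a multiple of 3, the run lengths `n / 3 + 1` and `(k - n) / 3 + 1` add
  -- up to `k / 3 + 2`.
  · refine split (3 * (k / 6)) (by omega) (by omega) fun e _ he =>
      exists_coprime_balanced hp (by omega) (by omega) (by omega) (by omega) ?_
    have h1 := four_mul_add_four_le_eight_pow (q := k / 6) (by omega)
    have h2 : 2 ^ (3 * (k / 6)) ≤ p ^ e :=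
      (Nat.pow_le_pow_right two_pos (by omega)).trans (Nat.pow_le_pow_left hp.two_le e)
    omega

theorem HasCycle.of_sorted {p r : ℕ} (h : ∀ a b c : ℕ, 0 < c → c ≤ b → b ≤ a →
      HasCycle (CycleStep ![p ^ a, p ^ b, p ^ c]) r) (a : Fin 3 → ℕ) (ha : ∀ i, 0 < a i) :
    HasCycle (CycleStep fun i => p ^ a i) r := by
  have hmono := Tuple.monotone_sort a
  refine HasCycle.reindex (m := fun i => p ^ a i) (Fin.revPerm.trans (Tuple.sort a)) ?_
  have h' := h (a (Tuple.sort a 2)) (a (Tuple.sort a 1)) (a (Tuple.sort a 0)) (ha _)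
    (hmono (by decide)) (hmono (by decide))
  have he : (fun i => p ^ a (Fin.revPerm.trans (Tuple.sort a) i)) =
      ![p ^ a (Tuple.sort a 2), p ^ a (Tuple.sort a 1), p ^ a (Tuple.sort a 0)] := by
    ext i
    fin_cases i <;> rfl
  rwa [← he] at h'

/-! ### Periodic words in three dimensions -/

/-- The position after `t` letters, the letter at time `s` being a step `ε s` in dimension `d s`. -/
def position {ι : Type*} [DecidableEq ι] (d : ℕ → ι) (ε : ℕ → ℤ) (t : ℕ) (i : ι) : ℤ :=
  ∑ s ∈ Finset.range t, if d s = i then ε s else 0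

section position

variable {ι : Type*} [DecidableEq ι] {d : ℕ → ι} {ε : ℕ → ℤ}

@[simp]
theorem position_zero (i : ι) : position d ε 0 i = 0 := by
  simp [position]

theorem position_succ (t : ℕ) (i : ι) :
    position d ε (t + 1) i = position d ε t i + if d t = i then ε t else 0 :=
  Finset.sum_range_succ _ _

theorem position_add_mul {D : ℕ} (hd : Function.Periodic d D) (hε : Function.Periodic ε D)
    (t n : ℕ) (i : ι) :
    position d ε (t + n * D) i = position d ε t i + n * position d ε D i := by
  have h : ∀ t, position d ε (t + D) i = position d ε t i + position d ε D i := fun t => by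
    induction t with
    | zero => simp
    | succ t ih =>
      rw [add_right_comm, position_succ, ih, position_succ, hd, hε]
      ring
  induction n with
  | zero => simp
  | succ n ih =>
    rw [add_mul, one_mul, ← add_assoc, h, ih]
    push_cast
    ring

end position

/-- Each repetition of the word adds its displacement. After `A` of them, `A * B * C` steps in all,
every coordinate has moved by a multiple of `A`, hence of its own modulus. -/
theorem hasCycle_of_word {A B C D : ℕ} {d : ℕ → Fin 3} {ε : ℕ → ℤ} (hBA : B ∣ A) (hCA : C ∣ A)
    (hD : D = C * B) (hd : Function.Periodic d D) (hε : Function.Periodic ε D)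
    (hε' : ∀ t, ε t = 1 ∨ ε t = -1) (hrun : ∀ t, d t ≠ d (t + 1))
    (hsurj : ∀ g : Fin 3 → ℤ, ∃ t n : ℕ, (A : ℤ) ∣ position d ε t 0 + n * position d ε D 0 - g 0 ∧
      (B : ℤ) ∣ position d ε t 1 + n * position d ε D 1 - g 1 ∧
      (C : ℤ) ∣ position d ε t 2 + n * position d ε D 2 - g 2) :
    HasCycle (CycleStep ![A, B, C]) 2 := by
  have hdvd : ∀ i, ((![A, B, C] i : ℕ) : ℤ) ∣ A := fun i => by
    rw [Int.natCast_dvd_natCast]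
    fin_cases i
    exacts [dvd_rfl, hBA, hCA]
  refine hasCycle_of_walk (position d ε) d (fun t => ⟨?_, fun j hj => ?_⟩) (fun t i => ?_)
    (fun g => ?_) fun s t hst hts => ?_
  · rw [position_succ]
    rcases hε' t with h | h <;> simp [h, sub_eq_add_neg]
  · simp [position_succ, hj.symm]
  · have h : ∏ i, ![A, B, C] i = A * D := by
      simp [Fin.prod_univ_three, hD, mul_assoc, mul_comm B]
    rw [h, position_add_mul hd hε, add_sub_cancel_left]
    exact (hdvd i).mul_right _
  · obtain ⟨t, n, h0, h1, h2⟩ := hsurj g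
    refine ⟨t + n * D, fun i => ?_⟩
    rw [position_add_mul hd hε]
    fin_cases i
    exacts [h0, h1, h2]
  · obtain rfl : t = s + 1 := by omega
    exact hrun s

/-- A word that uses `w₀` once and then `w₁` for `B - 1` times, all steps being positive. -/
theorem hasCycle_of_two_words {A B C : ℕ} (hA : 0 < A) (hB : 0 < B) (hC : 0 < C) (hCB : C ∣ B)
    (hBA : B ∣ A) (w₀ w₁ : ℕ → Fin 3) (hw : ∀ j, w₀ j = 1 ↔ w₁ j = 1)
    (h₀ : ∀ j, j + 1 < C → w₀ j ≠ w₀ (j + 1)) (h₁ : ∀ j, j + 1 < C → w₁ j ≠ w₁ (j + 1))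
    (hfst : w₁ 0 = 1) (hlst : w₁ (C - 1) ≠ 1)
    (hcop : IsCoprime (position w₁ 1 C 1) (B : ℤ))
    (hcnt : position w₀ 1 C 0 = position w₁ 1 C 0 + 1)
    (hpow : ∀ x : ℤ, IsCoprime (1 + B * x) (A : ℤ)) :
    HasCycle (CycleStep ![A, B, C]) 2 := by
  set w : ℕ → ℕ → Fin 3 := fun i => if i % B = 0 then w₀ else w₁ with hwdef
  set d : ℕ → Fin 3 := fun t => w (t / C) (t % C) with hddef
  have hdij : ∀ i j, j < C → d (C * i + j) = w i j := fun i j hj => by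
    simp only [hddef]
    rw [Nat.mul_add_div hC, Nat.div_eq_of_lt hj, Nat.mul_add_mod, Nat.mod_eq_of_lt hj, add_zero]
  have hper : Function.Periodic d (C * B) := fun t => by
    simp only [hddef, hwdef]
    rw [Nat.add_mul_div_left _ _ hC, Nat.add_mul_mod_self_left, Nat.add_mod_right]
  have hpos : ∀ i k j, j ≤ C →
      position d 1 (C * i + j) k = position d 1 (C * i) k + position (w i) 1 j k := by
    intro i k j
    induction j with
    | zero => simp
    | succ j ih =>
      intro hj
      rw [← add_assoc, position_succ, ih (by omega), position_succ, hdij i j (by omega), add_assoc]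
      rfl
  have hwi : ∀ i j, w i j = 1 ↔ w₁ j = 1 := fun i j => by
    simp only [hwdef]
    split_ifs
    exacts [hw j, Iff.rfl]
  have hpos₁ : ∀ i j, position (w i) 1 j 1 = position w₁ 1 j 1 := fun i j => by
    simp only [position, hwi]
  have hrow : ∀ i, position d 1 (C * i) 1 = i * position w₁ 1 C 1 := fun i => by
    induction i with
    | zero => simp
    | succ i ih =>
      rw [mul_add, mul_one, hpos i 1 C le_rfl, ih, hpos₁]
      push_cast
      ring
  have hcol : ∀ i, i < B →
      position d 1 (C * (i + 1)) 0 = 1 + (i + 1) * position w₁ 1 C 0 := fun i => by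
    induction i with
    | zero =>
      intro _
      have h := hpos 0 0 C le_rfl
      simp only [hwdef, Nat.zero_mod, if_true, mul_zero, zero_add, position_zero] at h
      simp [h, hcnt, add_comm]
    | succ i ih =>
      intro hi
      rw [mul_add, mul_one, hpos (i + 1) 0 C le_rfl, ih (by omega)]
      simp only [hwdef, Nat.mod_eq_of_lt hi]
      simp only [Nat.add_eq_zero_iff, one_ne_zero, and_false, if_false]
      push_cast
      ring
  have htot : ∀ t, position d 1 t 0 + position d 1 t 1 + position d 1 t 2 = t := fun t => by
    induction t with
    | zero => simp
    | succ t ih =>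
      push_cast
      rw [← ih]
      simp only [position_succ, Pi.one_apply]
      generalize d t = x
      fin_cases x <;> simp <;> ring
  have hκ : position d 1 (C * B) 0 = 1 + B * position w₁ 1 C 0 := by
    obtain ⟨b, rfl⟩ := Nat.exists_eq_succ_of_ne_zero hB.ne'
    rw [Nat.succ_eq_add_one, hcol b (by omega)]
    push_cast
    ring
  have hdvd : ∀ {x : ℤ}, (B : ℤ) ∣ x → (C : ℤ) ∣ x := fun h =>
    (Int.natCast_dvd_natCast.2 hCB).trans h
  refine hasCycle_of_word (ε := 1) hBA (hCB.trans hBA) rfl hper (fun _ => rfl) (fun _ => Or.inl rfl)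
    (fun t => ?_) fun g => ?_
  · obtain ⟨i, j, hj, rfl⟩ : ∃ i j, j < C ∧ t = C * i + j :=
      ⟨t / C, t % C, Nat.mod_lt _ hC, (Nat.div_add_mod t C).symm⟩
    rw [hdij i j hj]
    rcases Nat.lt_or_ge (j + 1) C with h | h
    · rw [add_assoc, hdij i (j + 1) h]
      simp only [hwdef]
      split_ifs
      exacts [h₀ j h, h₁ j h]
    · obtain rfl : j = C - 1 := by omega
      rw [show C * i + (C - 1) + 1 = C * (i + 1) + 0 by rw [mul_add]; omega, hdij _ _ hC,
        (hwi _ _).2 hfst]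
      exact fun h => hlst ((hwi _ _).1 h)
  -- All steps being positive, the coordinate sum is the time. Hence `s`, the row `i` and the
  -- repetition `n` can be chosen in turn, and coordinate 2 follows from the sum mod `C`.
  · obtain ⟨s, hsC, hs⟩ : ∃ s : ℕ, s < C ∧ (C : ℤ) ∣ s - (g 0 + g 1 + g 2) := by
      refine ⟨((g 0 + g 1 + g 2) % C).toNat, ?_, ?_⟩
      · have := Int.emod_lt_of_pos (g 0 + g 1 + g 2) (Int.natCast_pos.2 hC)
        omega
      · rw [Int.toNat_of_nonneg (Int.emod_nonneg _ (by omega)), Int.emod_def]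
        exact ⟨-((g 0 + g 1 + g 2) / C), by ring⟩
    obtain ⟨i, hi⟩ := exists_dvd_add_mul_sub hB hcop (position w₁ 1 s 1) (g 1)
    obtain ⟨n, hn⟩ := exists_dvd_add_mul_sub hA (hpow (position w₁ 1 C 0))
      (position d 1 (C * i + s) 0) (g 0)
    rw [← hκ] at hn
    have h1 : (B : ℤ) ∣ position d 1 (C * i + s) 1 + n * position d 1 (C * B) 1 - g 1 := by
      rw [hrow, hpos i 1 s hsC.le, hrow, hpos₁]
      obtain ⟨u, hu⟩ := hi
      exact ⟨u + n * position w₁ 1 C 1, by linear_combination hu⟩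
    refine ⟨C * i + s, n, hn, h1, ?_⟩
    have h2 := htot (C * i + s)
    have h3 := htot (C * B)
    have h4 := hdvd ((Int.natCast_dvd_natCast.2 hBA).trans hn)
    have h5 := hdvd h1
    push_cast at h2 h3
    obtain ⟨u, hu⟩ := hs
    obtain ⟨u', hu'⟩ := h4
    obtain ⟨v, hv⟩ := h5
    exact ⟨i + n * B + u - u' - v, by linear_combination h2 + n * h3 + hu - hu' - hv⟩

/-- The rows are `1 0 2 0 2 … 0` and `1 2 0 2 0 … 2`. As `C` is even, the part after the `1` has odd
length, so swapping 0 and 2 changes the number of zeros by one. -/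
theorem hasCycle_three_two_pow {a b c : ℕ} (hc : 0 < c) (hcb : c ≤ b) (hba : b ≤ a) :
    HasCycle (CycleStep ![2 ^ a, 2 ^ b, 2 ^ c]) 2 := by
  obtain ⟨e, he⟩ : ∃ e, 2 ^ c = 2 * (e + 1) := by
    obtain ⟨c, rfl⟩ := Nat.exists_eq_succ_of_ne_zero hc.ne'
    exact ⟨2 ^ c - 1, by rw [Nat.sub_add_cancel Nat.one_le_two_pow, pow_succ']⟩
  set w₀ : ℕ → Fin 3 := fun j => if j = 0 then 1 else if j % 2 = 1 then 0 else 2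
  set w₁ : ℕ → Fin 3 := fun j => if j = 0 then 1 else if j % 2 = 1 then 2 else 0
  have hone : position w₁ 1 (2 ^ c) 1 = 1 := by
    rw [he]
    clear he
    induction e with
    | zero => decide
    | succ e ih =>
      rw [show 2 * (e + 1 + 1) = 2 * (e + 1) + 1 + 1 by ring, position_succ, position_succ, ih]
      simp [w₁, Nat.add_mod]
  have hcnt : position w₀ 1 (2 ^ c) 0 = position w₁ 1 (2 ^ c) 0 + 1 := by
    rw [he]
    clear he
    induction e with
    | zero => decide
    | succ e ih =>
      rw [show 2 * (e + 1 + 1) = 2 * (e + 1) + 1 + 1 by ring]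
      simp only [position_succ _ (0 : Fin 3)] at ih ⊢
      simp [w₀, w₁, Nat.add_mod] at ih ⊢
      linarith
  refine hasCycle_of_two_words (by positivity) (by positivity) (by positivity) (pow_dvd_pow 2 hcb)
    (pow_dvd_pow 2 hba) w₀ w₁ (fun j => ?_) (fun j _ => ?_) (fun j _ => ?_) rfl ?_ ?_ hcnt
    fun x => ?_
  · simp only [w₀, w₁]
    split_ifs <;> decide
  · simp only [w₀]
    split_ifs <;> first | contradiction | omega
  · simp only [w₁]
    split_ifs <;> first | contradiction | omega
  · simp only [w₁, he]
    split_ifs <;> first | contradiction | omega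
  · rw [hone]
    exact isCoprime_one_left
  · push_cast
    refine IsCoprime.pow_right ⟨1, -(2 ^ (b - 1) * x), ?_⟩
    obtain ⟨b, rfl⟩ := Nat.exists_eq_succ_of_ne_zero (show b ≠ 0 by omega)
    simp only [Nat.succ_eq_add_one, Nat.add_sub_cancel, pow_succ]
    ring

/-- For odd `C`, a single leading `1` would leave an even alternating part with equally many zeros
either way. So two `1`s are used: `1 0 1 0 2 0 2 …` and `1 2 1 0 2 0 2 …` differ in one letter, and
2 is prime to `B`. The row must not end in the second `1`, whence `C ≥ 5`. -/
theorem hasCycle_three_of_five_le {p a b c : ℕ} (hp : Odd p) (hp0 : 0 < p) (hc : 0 < c)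
    (hcb : c ≤ b) (hba : b ≤ a) (h5 : 5 ≤ p ^ c) :
    HasCycle (CycleStep ![p ^ a, p ^ b, p ^ c]) 2 := by
  have hodd : p ^ c % 2 = 1 := Nat.odd_iff.1 hp.pow
  obtain ⟨n, hn⟩ : ∃ n, p ^ c = 5 + n := Nat.exists_eq_add_of_le h5
  set w₀ : ℕ → Fin 3 := fun j =>
    if j = 0 ∨ j = 2 then 1 else if j % 2 = 1 then 0 else 2
  set w₁ : ℕ → Fin 3 := fun j =>
    if j = 0 ∨ j = 2 then 1 else if j = 1 then 2 else if j % 2 = 1 then 0 else 2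
  have htwo : position w₁ 1 (p ^ c) 1 = 2 := by
    rw [hn]
    clear hn
    induction n with
    | zero => decide
    | succ n ih =>
      rw [← add_assoc, position_succ, ih]
      simp only [w₁]
      split_ifs <;> omega
  have hcnt : position w₀ 1 (p ^ c) 0 = position w₁ 1 (p ^ c) 0 + 1 := by
    rw [hn]
    clear hn
    induction n with
    | zero => decide
    | succ n ih =>
      have h : w₀ (5 + n) = w₁ (5 + n) := by
        simp only [w₀, w₁]
        split_ifs <;> omega
      rw [← add_assoc, position_succ, position_succ, ih, h]
      ring
  refine hasCycle_of_two_words (by positivity) (by positivity) (by positivity) (pow_dvd_pow p hcb)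
    (pow_dvd_pow p hba) w₀ w₁ (fun j => ?_) (fun j _ => ?_) (fun j _ => ?_) rfl ?_ ?_ hcnt
    fun x => ?_
  · simp only [w₀, w₁]
    split_ifs <;> decide
  · simp only [w₀]
    split_ifs <;> first | decide | omega | grind
  · simp only [w₁]
    split_ifs <;> first | decide | omega | grind
  · simp only [w₁]
    split_ifs <;> first | decide | omega
  · rw [htwo]
    exact_mod_cast Nat.isCoprime_iff_coprime.2 (Nat.coprime_two_left.2 hp.pow)
  · push_cast
    refine IsCoprime.pow_right ⟨1, -(p ^ (b - 1) * x), ?_⟩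
    obtain ⟨b, rfl⟩ := Nat.exists_eq_succ_of_ne_zero (show b ≠ 0 by omega)
    simp only [Nat.succ_eq_add_one, Nat.add_sub_cancel, pow_succ]
    ring

/-! ### Last dimension of length three -/

/-- A word for a torus whose last dimension has length three, with displacement `(1, -1, -1)`. -/
theorem hasCycle_of_word_three {A B : ℕ} {d : ℕ → Fin 3} {ε : ℕ → ℤ} (hA : 0 < A) (hBA : B ∣ A)
    (hB : 3 ∣ B) (hd : Function.Periodic d (3 * B)) (hε : Function.Periodic ε (3 * B))
    (hε' : ∀ t, ε t = 1 ∨ ε t = -1) (hrun : ∀ t, d t ≠ d (t + 1))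
    (h0 : position d ε (3 * B) 0 = 1) (h1 : (B : ℤ) ∣ position d ε (3 * B) 1 + 1)
    (h2 : (3 : ℤ) ∣ position d ε (3 * B) 2 + 1)
    (hcov : ∀ x y : ℤ, ∃ t, (B : ℤ) ∣ position d ε t 0 + position d ε t 1 - x ∧
      (3 : ℤ) ∣ position d ε t 0 + position d ε t 2 - y) :
    HasCycle (CycleStep ![A, B, 3]) 2 := by
  refine hasCycle_of_word hBA (hB.trans hBA) rfl hd hε hε' hrun fun g => ?_
  obtain ⟨t, ht1, ht2⟩ := hcov (g 0 + g 1) (g 0 + g 2)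
  -- The sums of coordinates 0, 1 and of coordinates 0, 2 are unchanged mod `B` and mod 3 by the
  -- displacement. Once `t` fixes them, `n` adjusts coordinate 0 and the others follow.
  obtain ⟨n, hn⟩ := exists_dvd_add_mul_sub hA isCoprime_one_left (position d ε t 0) (g 0)
  have hnB := (Int.natCast_dvd_natCast.2 hBA).trans hn
  have hn3 : (3 : ℤ) ∣ _ := (Int.natCast_dvd_natCast.2 (hB.trans hBA)).trans hn
  refine ⟨t, n, by rwa [h0], ?_, ?_⟩
  · obtain ⟨u, hu⟩ := ht1
    obtain ⟨v, hv⟩ := hnB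
    obtain ⟨w, hw⟩ := h1
    exact ⟨u - v + n * w, by linear_combination hu - hv + n * hw⟩
  · obtain ⟨u, hu⟩ := ht2
    obtain ⟨v, hv⟩ := hn3
    obtain ⟨w, hw⟩ := h2
    exact ⟨u - v + n * w, by push_cast; linear_combination hu - hv + n * hw⟩

/-- The nine quotient classes are covered by an explicit word. The word `v` of `hasCycle_three_odd`
would not do alone, since it begins and ends in dimension 1. -/
theorem hasCycle_three_three {A : ℕ} (hA : 0 < A) (h3A : 3 ∣ A) :
    HasCycle (CycleStep ![A, 3, 3]) 2 := by
  let d : ℕ → Fin 3 := fun t => [0, 1, 0, 1, 2, 1, 2, 0, 2].getD (t % 9) 0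
  let ε : ℕ → ℤ := fun t => [1, 1, 1, -1, 1, -1, -1, -1, -1].getD (t % 9) 1
  have hlt : ∀ t, t % 9 < 9 := fun t => Nat.mod_lt _ (by norm_num)
  refine hasCycle_of_word_three (d := d) (ε := ε) hA h3A dvd_rfl (fun t => ?_) (fun t => ?_)
    (fun t => ?_) (fun t => ?_) (by decide) (by decide) (by decide) fun x y => ?_
  · simp only [d, Nat.add_mod_right]
  · simp only [ε, Nat.add_mod_right]
  · have h : ∀ s < 9, [1, 1, 1, -1, 1, -1, -1, -1, -1].getD s 1 = (1 : ℤ) ∨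
        [1, 1, 1, -1, 1, -1, -1, -1, -1].getD s 1 = (-1 : ℤ) := by decide
    exact h _ (hlt t)
  · have h : ∀ s < 9, ([0, 1, 0, 1, 2, 1, 2, 0, 2] : List (Fin 3)).getD s 0 ≠
        [0, 1, 0, 1, 2, 1, 2, 0, 2].getD ((s + 1) % 9) 0 := by decide
    have := h _ (hlt t)
    rwa [Nat.mod_add_mod] at this
  · have h : ∀ u < 3, ∀ v < 3, ∃ t < 9, (3 : ℤ) ∣ position d ε t 0 + position d ε t 1 - (u : ℕ) ∧
        (3 : ℤ) ∣ position d ε t 0 + position d ε t 2 - (v : ℕ) := by decide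
    obtain ⟨t, -, h1, h2⟩ := h (x % 3).toNat (by omega) (y % 3).toNat (by omega)
    exact ⟨t, by push_cast; omega, by omega⟩

/-- With `B = 2 * m + 3`, the word is `v` followed by `m` copies of `u`, of `9 + 6 * m = 3 * B`
letters. The displacements `(1, 2, 2)` of `v` and `(0, 2, 0)` of `u` add up to `(1, B - 1, 2)`, as
required mod `B` and mod 3. -/
theorem hasCycle_three_odd {A m : ℕ} (hA : 0 < A) (hm : 0 < m) (hm3 : 3 ∣ m)
    (hBA : 2 * m + 3 ∣ A) : HasCycle (CycleStep ![A, 2 * m + 3, 3]) 2 := by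
  let v : List (Fin 3) := [1, 0, 1, 2, 1, 0, 2, 0, 1]
  let v' : List ℤ := [1, 1, 1, 1, -1, -1, 1, 1, 1]
  let u : List (Fin 3) := [0, 1, 0, 2, 1, 2]
  let u' : List ℤ := [1, 1, -1, -1, 1, 1]
  let l : ℕ → Fin 3 := fun t => if t < 9 then v.getD t 0 else u.getD ((t - 9) % 6) 0
  let l' : ℕ → ℤ := fun t => if t < 9 then v'.getD t 1 else u'.getD ((t - 9) % 6) 1
  let d : ℕ → Fin 3 := fun t => l (t % (3 * (2 * m + 3)))
  let ε : ℕ → ℤ := fun t => l' (t % (3 * (2 * m + 3)))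
  have hlt : ∀ t, t % (3 * (2 * m + 3)) < 3 * (2 * m + 3) := fun t => Nat.mod_lt _ (by omega)
  have hl : ∀ i j, j < 6 → l (9 + 6 * i + j) = u.getD j 0 := fun i j hj => by
    simp only [l]
    rw [if_neg (by omega), show (9 + 6 * i + j - 9) % 6 = j by omega]
  have hl' : ∀ i j, j < 6 → l' (9 + 6 * i + j) = u'.getD j 1 := fun i j hj => by
    simp only [l']
    rw [if_neg (by omega), show (9 + 6 * i + j - 9) % 6 = j by omega]
  have hV : ∀ t ≤ 9, ∀ k, position d ε t k =
      position (fun t => v.getD t 0) (fun t => v'.getD t 1) t k := by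
    intro t ht k
    refine Finset.sum_congr rfl fun s hs => ?_
    have hs' : s < 9 := (Finset.mem_range.1 hs).trans_le ht
    simp only [d, ε, l, l', Nat.mod_eq_of_lt (show s < 3 * (2 * m + 3) by omega), hs', if_true]
  have hU : ∀ i < m, ∀ j ≤ 6, ∀ k, position d ε (9 + 6 * i + j) k = position d ε (9 + 6 * i) k +
      position (fun t => u.getD t 0) (fun t => u'.getD t 1) j k := by
    intro i hi j
    induction j with
    | zero => simp
    | succ j ih =>
      intro hj k
      rw [← add_assoc, position_succ, ih (by omega), position_succ, add_assoc]
      simp only [d, ε, Nat.mod_eq_of_lt (show 9 + 6 * i + j < 3 * (2 * m + 3) by omega),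
        hl i j (by omega), hl' i j (by omega)]
  have hblock : ∀ i ≤ m, position d ε (9 + 6 * i) 0 = 1 ∧ position d ε (9 + 6 * i) 1 = 2 + 2 * i ∧
      position d ε (9 + 6 * i) 2 = 2 := by
    intro i
    induction i with
    | zero =>
      intro _
      rw [mul_zero, add_zero, hV 9 le_rfl, hV 9 le_rfl, hV 9 le_rfl]
      decide
    | succ i ih =>
      intro hi
      obtain ⟨h0, h1, h2⟩ := ih (by omega)
      have h := hU i (by omega) 6 le_rfl
      rw [show 9 + 6 * (i + 1) = 9 + 6 * i + 6 by ring, h, h, h, h0, h1, h2]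
      refine ⟨by decide, ?_, by decide⟩
      rw [show position (fun t => u.getD t 0) (fun t => u'.getD t 1) 6 1 = 2 by decide]
      push_cast
      ring
  have hD : 3 * (2 * m + 3) = 9 + 6 * m := by ring
  refine hasCycle_of_word_three (d := d) (ε := ε) hA hBA (by omega) (fun t => ?_) (fun t => ?_)
    (fun t => ?_) (fun t => ?_) ?_ ?_ ?_ fun x y => ?_
  · simp only [d, Nat.add_mod_right]
  · simp only [ε, Nat.add_mod_right]
  · have h1 : ∀ s < 9, v'.getD s 1 = 1 ∨ v'.getD s 1 = -1 := by decide
    have h2 : ∀ s < 6, u'.getD s 1 = 1 ∨ u'.getD s 1 = -1 := by decide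
    simp only [ε, l']
    split_ifs with h
    exacts [h1 _ h, h2 _ (Nat.mod_lt _ (by norm_num))]
  · have h1 : ∀ s < 8, v.getD s 0 ≠ v.getD (s + 1) 0 := by decide
    have h2 : ∀ s < 6, u.getD s 0 ≠ u.getD ((s + 1) % 6) 0 := by decide
    have hs := hlt t
    have hd' : d (t + 1) = l ((t % (3 * (2 * m + 3)) + 1) % (3 * (2 * m + 3))) := by
      simp only [d, Nat.mod_add_mod]
    rw [hd']
    change l (t % (3 * (2 * m + 3))) ≠ _
    generalize t % (3 * (2 * m + 3)) = s at hs
    rcases Nat.lt_or_ge (s + 1) (3 * (2 * m + 3)) with hs' | hs'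
    · rw [Nat.mod_eq_of_lt hs']
      rcases lt_trichotomy s 8 with h | rfl | h
      · simp only [l, show s < 9 by omega, show s + 1 < 9 by omega, if_true]
        exact h1 s h
      · decide
      · have := h2 _ (Nat.mod_lt (s - 9) (by norm_num))
        rw [Nat.mod_add_mod] at this
        simp only [l, show ¬s < 9 by omega, show ¬s + 1 < 9 by omega, if_false]
        rwa [show s + 1 - 9 = s - 9 + 1 by omega]
    · obtain rfl : s = 9 + 6 * (m - 1) + 5 := by omega
      rw [hl _ _ (by norm_num), show (9 + 6 * (m - 1) + 5 + 1) % (3 * (2 * m + 3)) = 0 by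
        rw [show 9 + 6 * (m - 1) + 5 + 1 = 3 * (2 * m + 3) by omega, Nat.mod_self]]
      decide
  · rw [hD, (hblock m le_rfl).1]
  · rw [hD, (hblock m le_rfl).2.1]
    exact ⟨1, by push_cast; ring⟩
  · rw [hD, (hblock m le_rfl).2.2]
    norm_num
  -- The sum of coordinates 0 and 1 is represented in `1, …, B`: the word `v` covers 1, 2, 3, and
  -- copy `i` of `u` covers `4 + 2 * i` and `5 + 2 * i`, each with all three residues of the other
  -- sum.
  · obtain ⟨q, hq, hqx⟩ : ∃ q < 2 * m + 3, ((2 * m + 3 : ℕ) : ℤ) ∣ (q : ℕ) + 1 - x := by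
      refine ⟨((x - 1) % (2 * m + 3 : ℕ)).toNat, ?_, ?_⟩
      · have := Int.emod_lt_of_pos (x - 1) (Int.natCast_pos.2 (show 0 < 2 * m + 3 by omega))
        omega
      · rw [Int.toNat_of_nonneg (Int.emod_nonneg _ (by omega)), Int.emod_def]
        exact ⟨-((x - 1) / (2 * m + 3 : ℕ)), by ring⟩
    obtain ⟨c, hc, hcy⟩ : ∃ c < 3, (3 : ℤ) ∣ (c : ℕ) - y := ⟨(y % 3).toNat, by omega, by omega⟩
    suffices h : ∃ t, position d ε t 0 + position d ε t 1 = q + 1 ∧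
        (3 : ℤ) ∣ position d ε t 0 + position d ε t 2 - c by
      obtain ⟨t, ht, ht'⟩ := h
      exact ⟨t, by rwa [ht], by omega⟩
    have hfirst : ∀ q < 3, ∀ c < 3, ∃ t ≤ 9,
        position (fun t => v.getD t 0) (fun t => v'.getD t 1) t 0 +
          position (fun t => v.getD t 0) (fun t => v'.getD t 1) t 1 = (q : ℕ) + 1 ∧
        (3 : ℤ) ∣ position (fun t => v.getD t 0) (fun t => v'.getD t 1) t 0 +
          position (fun t => v.getD t 0) (fun t => v'.getD t 1) t 2 - (c : ℕ) := by decide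
    have hnext : ∀ e < 2, ∀ c < 3, ∃ j ≤ 6,
        position (fun t => u.getD t 0) (fun t => u'.getD t 1) j 0 +
          position (fun t => u.getD t 0) (fun t => u'.getD t 1) j 1 = (e : ℕ) + 1 ∧
        (3 : ℤ) ∣ position (fun t => u.getD t 0) (fun t => u'.getD t 1) j 0 +
          position (fun t => u.getD t 0) (fun t => u'.getD t 1) j 2 - (c : ℕ) := by decide
    rcases Nat.lt_or_ge q 3 with h | h
    · obtain ⟨t, ht, h1, h2⟩ := hfirst q h c hc
      exact ⟨t, by rw [hV t ht, hV t ht, h1], by rwa [hV t ht, hV t ht]⟩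
    · obtain ⟨i, e, he, rfl⟩ : ∃ i e, e < 2 ∧ q = 3 + 2 * i + e :=
        ⟨(q - 3) / 2, (q - 3) % 2, by omega, by omega⟩
      obtain ⟨j, hj, h1, h2⟩ := hnext e he c hc
      obtain ⟨b0, b1, b2⟩ := hblock i (by omega)
      refine ⟨9 + 6 * i + j, ?_, ?_⟩ <;>
        rw [hU i (by omega) j hj, hU i (by omega) j hj, b0]
      · rw [b1]
        push_cast
        linarith
      · rw [b2]
        omega

/-! ### Conclusion -/

theorem hasCycle_three {p : ℕ} (hp : p.Prime) (a b c : ℕ) (hc : 0 < c) (hcb : c ≤ b)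
    (hba : b ≤ a) : HasCycle (CycleStep ![p ^ a, p ^ b, p ^ c]) 2 := by
  rcases hp.eq_two_or_odd' with rfl | hodd
  · exact hasCycle_three_two_pow hc hcb hba
  rcases Nat.lt_or_ge (p ^ c) 5 with h | h
  · have h3 : p ^ c = 3 := by
      have h1 := Nat.odd_iff.1 (hodd.pow (n := c))
      have h2 := Nat.one_lt_pow hc.ne' hp.one_lt
      omega
    obtain rfl : p = 3 := by
      have h1 : p ∣ 3 := h3 ▸ dvd_pow_self p hc.ne'
      exact (Nat.prime_dvd_prime_iff_eq hp Nat.prime_three).1 h1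
    rw [h3]
    rcases hcb.eq_or_lt with rfl | hlt
    · rw [h3]
      exact hasCycle_three_three (by positivity) (dvd_pow_self 3 (by omega))
    · obtain ⟨n, rfl⟩ : ∃ n, b = n + 2 := Nat.exists_eq_add_of_le' (by omega)
      have hn := Nat.odd_iff.1 (hodd.pow (n := n))
      have hb : 3 ^ (n + 2) = 2 * (3 * (3 * (3 ^ n / 2) + 1)) + 3 := by
        rw [pow_add]
        omega
      have hdvd := pow_dvd_pow 3 hba
      rw [hb] at hdvd ⊢
      exact hasCycle_three_odd (by positivity) (by omega) (Dvd.intro _ rfl) hdvd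
  · exact hasCycle_three_of_five_le hodd hp.pos hc hcb hba h

end RunLength

theorem mainTheorem2 (p : ℕ) (hp : p.Prime) (k : ℕ) (m : Fin k → ℕ) (hm : ∀ i, 2 ≤ m i)
    (r : ℕ) (hr : 0 < r) (hG : Nat.card (∀ i, Fin (m i)) = p ^ r) :
    k / 3 + 1 ≤ RunLength.maxRunLength fun i : Fin k => SimpleGraph.cycleGraph (m i) := by
  have hprod : ∏ i, m i = p ^ r := by simpa [Nat.card_pi] using hG
  have hk : 0 < k := by
    rcases Nat.eq_zero_or_pos k with rfl | hk
    · exact absurd hprod.symm (by simpa using ⟨hp.ne_one, hr.ne'⟩)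
    · exact hk
  have ha : ∀ i, ∃ a, m i = p ^ a := fun i => by
    obtain ⟨a, -, h⟩ := (Nat.dvd_prime_pow hp).1
      (hprod ▸ Finset.dvd_prod_of_mem m (Finset.mem_univ i))
    exact ⟨a, h⟩
  choose a ha using ha
  obtain rfl : m = fun i => p ^ a i := funext ha
  have ha0 : ∀ i, 0 < a i := fun i => Nat.pos_of_ne_zero fun h => by
    have := hm i
    simp [h] at this
  exact (RunLength.hasCycle_of_three hp
    (RunLength.HasCycle.of_sorted (RunLength.hasCycle_three hp)) k (Fin k) (Fintype.card_fin k)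
    hk a ha0).le_maxRunLength_cycleGraph hm
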